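/- Let $A$ be a finite set and let $P_1,P_2$ be two probability mass functions on $A$ with $P_1(a)>0$ and $P_2(a)>0$ for all $a\in A$. For $n\ge1$ let $P_j^n$ be the product distribution on $A^n$. A test between the hypotheses $P_1^n$ and $P_2^n$ is a decision region $C_n\subset A^n$ (one declares $P_1^n$ if the sample lies in $C_n$, and $P_2^n$ otherwise); its two error probabilities are $\alpha_n=P_1^n(C_n^c)$ and $\beta_n=P_2^n(C_n)$. Let $\log$ be the natural logarithm (with $\log 0=-\infty$), and let $$H(\mu\|\nu)=\sum_s\mu(s)\log\frac{\mu(s)}{\nu(s)}$$ denote the relative entropy between probability mass functions on a finite set. For $\alpha\in[0,1]$ define the error exponent $\varepsilon(\alpha)=-R(\alpha;P_1,P_2)$, where $$R(\alpha;P_1,P_2)=\inf_Q\Big\{\inf_W H(W\|P_1\times Q)+\sum_{y\in A}Q(y)\log P_2(y)\Big\};$$ here $Q$ ranges over all probability mass functions on $A$, and $W$ over all probability mass functions on $A\times A$ with first marginal $P_1$, second marginal $Q$ and $W\{(x,y):x\ne y\}\le\alpha$ (the inner infimum is $+\infty$ if there is no such $W$). Then: (i) For every sequence of tests $\{C_n\}$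 and every $n\ge1$ such that $C_n$ is nonempty, $\beta_n\ge e^{-n\varepsilon(\alpha_n)}$. (ii) For every sequence of tests $\{C_n\}$ with $\alpha_n\to0$, $$\liminf_{n\to\infty}\frac1n\log\beta_n\ge-H(P_1\|P_2).$$ (iii) There exists a sequence of tests $\{C_n\}$ with $\alpha_n\to0$ and $\frac1n\log\beta_n\to-H(P_1\|P_2)$ as $n\to\infty$. -/

import Mathlib

open Filter Topology

noncomputable section

namespace SphereCovering

variable {A : Type*}

/-- The product mass `M^n(C) = ∑_{y ∈ C} ∏_i M(y_i)` of a set `C ⊆ A^n`.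
For a probability mass function `M` this is the probability of `C` under the product
distribution. -/
def prodMass (M : A → ℝ) {n : ℕ} (C : Finset (Fin n → A)) : ℝ :=
  ∑ y ∈ C, ∏ i, M (y i)

open Classical in
/-- The relative entropy `H(μ‖ν) = ∑_s μ(s) log (μ(s)/ν(s))` between two probability mass
functions on a finite set, in nats, with `0 log (0/·) = 0` and with the value `+∞` when `μ` is
not absolutely continuous with respect to `ν`. -/
def relEntropy {S : Type*} [Fintype S] (μ ν : S → ℝ) : EReal :=
  if ∀ s, ν s = 0 → μ s = 0 then ((∑ s, μ s * Real.log (μ s / ν s) : ℝ) : EReal) else ⊤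

/-- `𝓜(P,Q,D)`: the probability mass functions `W` on `A × A` with first marginal `P`, second
marginal `Q` and `E_W[ρ(X,Y)] ≤ D`. -/
def couplings [Fintype A] (ρ : A → A → ℝ) (P Q : A → ℝ) (D : ℝ) : Set (A × A → ℝ) :=
  {W | W ∈ stdSimplex ℝ (A × A) ∧ (∀ x, ∑ y, W (x, y) = P x) ∧ (∀ y, ∑ x, W (x, y) = Q y) ∧
    ∑ z, W z * ρ z.1 z.2 ≤ D}

/-- `I(P,Q,D) = inf_{W ∈ 𝓜(P,Q,D)} H(W‖P×Q)`, equal to `+∞` if `𝓜(P,Q,D)` is empty. -/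
def infoI [Fintype A] (ρ : A → A → ℝ) (P Q : A → ℝ) (D : ℝ) : EReal :=
  ⨅ W ∈ couplings ρ P Q D, relEntropy W (fun z => P z.1 * Q z.2)

/-- The rate function `R(D;P,M) = inf_Q { I(P,Q,D) + E_Q[log M(Y)] }`, the infimum being over all
probability mass functions `Q` on `A`. -/
def rateR [Fintype A] (ρ : A → A → ℝ) (P M : A → ℝ) (D : ℝ) : EReal :=
  ⨅ Q ∈ stdSimplex ℝ A, infoI ρ P Q D + ((∑ y, Q y * Real.log (M y) : ℝ) : EReal)

/-- The single-letter Hamming distortion. -/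
def hamming [DecidableEq A] (x y : A) : ℝ := if x = y then 0 else 1

/-- The error exponent `ε(α) = -R(α;P₁,P₂)`, for Hamming distortion. -/
def errorExponent [Fintype A] [DecidableEq A] (P₁ P₂ : A → ℝ) (α : ℝ) : EReal :=
  -rateR hamming P₁ P₂ α

/-- The probability `α_n = P₁^n(C_n^c)` of rejecting `P₁` when it is true, for the test with
decision region `C`. -/
def errorOne [Fintype A] [DecidableEq A] (P₁ : A → ℝ) {n : ℕ} (C : Finset (Fin n → A)) : ℝ :=
  prodMass P₁ Cᶜ

/-- The probability `β_n = P₂^n(C_n)` of accepting `P₁` when `P₂` is true. -/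
def errorTwo (P₂ : A → ℝ) {n : ℕ} (C : Finset (Fin n → A)) : ℝ :=
  prodMass P₂ C

/-- `(1/n) log b` for `b ≥ 0`, with `log 0 = -∞`. -/
def normLog (n : ℕ) (b : ℝ) : EReal :=
  ((1 / (n : ℝ) : ℝ) : EReal) * ENNReal.log (ENNReal.ofReal b)

end SphereCovering

end

/-! The bound at finite `n` is a covering argument. Let `φ` fix `C` pointwise and send its
complement to one point of `C`. With `x` drawn from `P₁^n`, the joint law `W i` of `(x i, φ x i)`
couples `P₁` to `Q i` with Hamming cost at most `P₁^n(Cᶜ)`, so its single-letter cost is at least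
the rate `R`. By Jensen, the exponential of the sum of these costs is at most a sum over `x` of
`P₂^n(φ x)` times the conditional weights `W i / Q i`; over each fibre of `φ` these weights sum to
at most 1, which leaves `P₂^n(C)`. Every coordinate has the same distortion bound, so convexity of
`R` is not needed.

The asymptotic statements rest on a change of measure: where the log-likelihood ratio is near its
mean, `P₂^n` is `P₁^n` times `exp(-n H)` up to a subexponential factor, and Chebyshev gives this set
`P₁^n`-mass tending to 1. -/

namespace SphereCovering

open Finset

/-! ### Push-forward laws and their marginals -/

section Law

variable {Ω S : Type*} [Fintype Ω] [DecidableEq S]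

/-- The mass function of `f` under the mass function `p`. -/
def law (p : Ω → ℝ) (f : Ω → S) (s : S) : ℝ := ∑ ω, if f ω = s then p ω else 0

lemma sum_law_mul [Fintype S] (p : Ω → ℝ) (f : Ω → S) (g : S → ℝ) :
    ∑ s, law p f s * g s = ∑ ω, p ω * g (f ω) := by
  simp only [law, Finset.sum_mul]
  rw [Finset.sum_comm]
  refine Finset.sum_congr rfl fun ω _ => ?_
  simp [ite_mul]

lemma law_nonneg {p : Ω → ℝ} (hp : ∀ ω, 0 ≤ p ω) (f : Ω → S) (s : S) : 0 ≤ law p f s :=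
  Finset.sum_nonneg fun ω _ => by split_ifs <;> simp [hp]

lemma law_apply_pos {p : Ω → ℝ} (hp : ∀ ω, 0 < p ω) (f : Ω → S) (ω : Ω) :
    0 < law p f (f ω) :=
  Finset.sum_pos' (fun ω' _ => by split_ifs <;> simp [(hp ω').le]) ⟨ω, mem_univ _, by simp [hp]⟩

lemma law_mem_stdSimplex [Fintype S] {p : Ω → ℝ} (hp : p ∈ stdSimplex ℝ Ω) (f : Ω → S) :
    law p f ∈ stdSimplex ℝ S := by
  refine ⟨law_nonneg hp.1 f, ?_⟩
  have := sum_law_mul p f fun _ => 1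
  simpa [hp.2] using this

variable {T : Type*} [DecidableEq T]

lemma sum_law_prod_left [Fintype T] (p : Ω → ℝ) (f : Ω → S) (g : Ω → T) (s : S) :
    ∑ t, law p (fun ω => (f ω, g ω)) (s, t) = law p f s := by
  simp only [law]
  rw [Finset.sum_comm]
  refine Finset.sum_congr rfl fun ω _ => ?_
  by_cases h : f ω = s <;> simp [Prod.ext_iff, h]

lemma sum_law_prod_right [Fintype S] (p : Ω → ℝ) (f : Ω → S) (g : Ω → T) (t : T) :
    ∑ s, law p (fun ω => (f ω, g ω)) (s, t) = law p g t := by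
  simp only [law]
  rw [Finset.sum_comm]
  refine Finset.sum_congr rfl fun ω _ => ?_
  by_cases h : g ω = t <;> simp [Prod.ext_iff, h]

end Law

/-! ### Moments under product distributions -/

section Product

variable {A : Type*} [Fintype A] {n : ℕ}

lemma sum_prod_mul_prod (P : A → ℝ) (f : Fin n → A → ℝ) :
    ∑ x : Fin n → A, (∏ k, P (x k)) * ∏ k, f k (x k) = ∏ k, ∑ a, P a * f k a := by
  classical
  rw [Finset.prod_univ_sum, Fintype.piFinset_univ]
  exact Finset.sum_congr rfl fun x _ => Finset.prod_mul_distrib.symm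

lemma prod_mem_stdSimplex {P : A → ℝ} (hP : P ∈ stdSimplex ℝ A) :
    (fun x : Fin n → A => ∏ k, P (x k)) ∈ stdSimplex ℝ (Fin n → A) := by
  refine ⟨fun x => Finset.prod_nonneg fun k _ => hP.1 _, ?_⟩
  have := sum_prod_mul_prod (n := n) P fun _ _ => 1
  simpa [hP.2] using this

lemma sum_prod_mul_apply {P : A → ℝ} (hP : ∑ a, P a = 1) (g : A → ℝ) (i : Fin n) :
    ∑ x : Fin n → A, (∏ k, P (x k)) * g (x i) = ∑ a, P a * g a := by
  have := sum_prod_mul_prod P fun k a => if k = i then g a else 1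
  have h : ∀ k, ∑ a, P a * (if k = i then g a else 1) = if k = i then ∑ a, P a * g a else 1 := by
    intro k
    split_ifs <;> simp [hP]
  simp_rw [h] at this
  simpa using this

lemma sum_prod_mul_apply_mul_apply {P : A → ℝ} {g : A → ℝ}
    (hg : ∑ a, P a * g a = 0) {i j : Fin n} (hij : i ≠ j) :
    ∑ x : Fin n → A, (∏ k, P (x k)) * (g (x i) * g (x j)) = 0 := by
  have := sum_prod_mul_prod P fun k a => (if k = i then g a else 1) * (if k = j then g a else 1)
  -- Since `i ≠ j`, the factor at `i` is the mean of `g`, which is zero.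
  rw [Finset.prod_eq_zero (mem_univ i) (by simpa [hij] using hg)] at this
  simp_rw [Finset.prod_mul_distrib] at this
  simpa using this

/-- Variance of a sum of independent centred variables. -/
lemma sum_prod_mul_sq {P : A → ℝ} (hP : ∑ a, P a = 1) {g : A → ℝ} (hg : ∑ a, P a * g a = 0) :
    ∑ x : Fin n → A, (∏ k, P (x k)) * (∑ i, g (x i)) ^ 2 = n * ∑ a, P a * g a ^ 2 := by
  have h : ∀ x : Fin n → A, (∏ k, P (x k)) * (∑ i, g (x i)) ^ 2
      = ∑ i, ∑ j, (∏ k, P (x k)) * (g (x i) * g (x j)) := fun x => by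
    rw [sq, Finset.sum_mul_sum, Finset.mul_sum]
    simp_rw [Finset.mul_sum]
  simp_rw [h]
  rw [Finset.sum_comm]
  have h2 : ∀ i : Fin n, ∑ x : Fin n → A, ∑ j, (∏ k, P (x k)) * (g (x i) * g (x j))
      = ∑ a, P a * g a ^ 2 := fun i => by
    rw [Finset.sum_comm, Finset.sum_eq_single i]
    · simp_rw [← sq]
      exact sum_prod_mul_apply hP (fun a => g a ^ 2) i
    · exact fun j _ hj => sum_prod_mul_apply_mul_apply hg hj.symm
    · simp
  simp [h2]

end Product

/-! ### The sphere-covering bound for finite `n` -/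

section Converse

variable {A : Type*} [Fintype A] {P₁ P₂ : A → ℝ} {n : ℕ}

/-- As `P₁` is positive, `P₁ × Q` vanishes only where the marginal `Q` of `W` does, so absolute
continuity is automatic and the entropy is a real sum. -/
lemma rateR_le {ρ : A → A → ℝ} {D : ℝ} (hpos : ∀ a, 0 < P₁ a) {Q : A → ℝ} {W : A × A → ℝ}
    (hQ : Q ∈ stdSimplex ℝ A) (hW : W ∈ couplings ρ P₁ Q D) :
    rateR ρ P₁ P₂ D ≤ ((∑ z, W z * Real.log (W z / (P₁ z.1 * Q z.2)) +
      ∑ y, Q y * Real.log (P₂ y) : ℝ) : EReal) := by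
  refine (iInf₂_le Q hQ).trans ?_
  rw [EReal.coe_add]
  refine add_le_add_left ((iInf₂_le W hW).trans ?_) _
  rw [relEntropy, if_pos]
  rintro ⟨a, b⟩ h
  have hb : Q b = 0 := by simpa [(hpos a).ne'] using h
  rw [← hW.2.2.1 b] at hb
  exact (Finset.sum_eq_zero_iff_of_nonneg fun a _ => hW.1.1 (a, b)).1 hb a (mem_univ _)

/-- Single-letter lower bound for the product mass of the range of a map `φ`, in terms of the
joint laws of the coordinates of `x` and `φ x`. -/
lemma exp_sum_le_prodMass [DecidableEq A] (hP₁ : P₁ ∈ stdSimplex ℝ A) (hpos₁ : ∀ a, 0 < P₁ a)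
    (hpos₂ : ∀ a, 0 < P₂ a) {C : Finset (Fin n → A)} {φ : (Fin n → A) → Fin n → A}
    (hφ : ∀ x, φ x ∈ C) {p : (Fin n → A) → ℝ} (hp : p = fun x => ∏ k, P₁ (x k))
    {W : Fin n → A × A → ℝ} (hW : W = fun i => law p fun x => (x i, φ x i))
    {Q : Fin n → A → ℝ} (hQ : Q = fun i => law p fun x => φ x i) :
    Real.exp (∑ i, (∑ z, W i z * Real.log (W i z / (P₁ z.1 * Q i z.2)) +
      ∑ y, Q i y * Real.log (P₂ y))) ≤ prodMass P₂ C := by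
  have hps : p ∈ stdSimplex ℝ (Fin n → A) := hp ▸ prod_mem_stdSimplex hP₁
  have hpp : ∀ x, 0 < p x := fun x => by
    rw [hp]; exact Finset.prod_pos fun k _ => hpos₁ _
  have hWp : ∀ i x, 0 < W i (x i, φ x i) := fun i x => by
    rw [hW]; exact law_apply_pos hpp (fun x => (x i, φ x i)) x
  have hQp : ∀ i x, 0 < Q i (φ x i) := fun i x => by
    rw [hQ]; exact law_apply_pos hpp (fun x => φ x i) x
  have hW0 : ∀ i z, 0 ≤ W i z := fun i z => by rw [hW]; exact law_nonneg hps.1 _ _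
  have hQ0 : ∀ i z, 0 ≤ Q i z := fun i z => by rw [hQ]; exact law_nonneg hps.1 _ _
  have hWQ : ∀ i b, ∑ a, W i (a, b) = Q i b := fun i b => by
    rw [hW, hQ]; exact sum_law_prod_right _ _ _ _
  have hexpand : ∑ i, (∑ z, W i z * Real.log (W i z / (P₁ z.1 * Q i z.2)) +
      ∑ y, Q i y * Real.log (P₂ y)) = ∑ x, p x * ∑ i, Real.log
        (W i (x i, φ x i) / (P₁ (x i) * Q i (φ x i)) * P₂ (φ x i)) := by
    simp_rw [Finset.mul_sum]
    rw [Finset.sum_comm]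
    refine Finset.sum_congr rfl fun i _ => ?_
    have h1 : ∑ z, W i z * Real.log (W i z / (P₁ z.1 * Q i z.2))
        = ∑ x, p x * Real.log (W i (x i, φ x i) / (P₁ (x i) * Q i (φ x i))) := by
      rw [← sum_law_mul p (fun x => (x i, φ x i))
        (fun z => Real.log (W i z / (P₁ z.1 * Q i z.2))), hW]
    have h2 : ∑ y, Q i y * Real.log (P₂ y) = ∑ x, p x * Real.log (P₂ (φ x i)) := by
      rw [← sum_law_mul p (fun x => φ x i) (fun y => Real.log (P₂ y)), hQ]
    rw [h1, h2, ← Finset.sum_add_distrib]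
    refine Finset.sum_congr rfl fun x _ => ?_
    rw [Real.log_mul (div_pos (hWp i x) (mul_pos (hpos₁ _) (hQp i x))).ne' (hpos₂ _).ne', mul_add]
  rw [hexpand]
  have hjensen := convexOn_exp.map_sum_le (t := univ) (w := p)
    (p := fun x => ∑ i, Real.log (W i (x i, φ x i) / (P₁ (x i) * Q i (φ x i)) * P₂ (φ x i)))
    (fun x _ => hps.1 x) hps.2 (fun _ _ => Set.mem_univ _)
  simp only [smul_eq_mul] at hjensen
  refine hjensen.trans ?_
  -- The weight `p x` cancels the `P₁` in the denominators.
  have hterm : ∀ x, p x * Real.exp (∑ i, Real.log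
      (W i (x i, φ x i) / (P₁ (x i) * Q i (φ x i)) * P₂ (φ x i)))
      = (∏ i, P₂ (φ x i)) * ∏ i, W i (x i, φ x i) / Q i (φ x i) := fun x => by
    rw [Real.exp_sum, hp, ← Finset.prod_mul_distrib, ← Finset.prod_mul_distrib]
    refine Finset.prod_congr rfl fun i _ => ?_
    rw [Real.exp_log (mul_pos (div_pos (hWp i x) (mul_pos (hpos₁ _) (hQp i x))) (hpos₂ _))]
    have := (hpos₁ (x i)).ne'
    have := (hQp i x).ne'
    field_simp
  simp_rw [hterm]
  rw [← Finset.sum_fiberwise_of_maps_to (g := φ) (t := C) (fun x _ => hφ x), prodMass]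
  refine Finset.sum_le_sum fun y _ => ?_
  have hfib : ∑ x with φ x = y, (∏ i, P₂ (φ x i)) * ∏ i, W i (x i, φ x i) / Q i (φ x i)
      = ∑ x with φ x = y, (∏ i, P₂ (y i)) * ∏ i, W i (x i, y i) / Q i (y i) :=
    Finset.sum_congr rfl fun x hx => by rw [(Finset.mem_filter.1 hx).2]
  rw [hfib, ← Finset.mul_sum]
  refine mul_le_of_le_one_right (Finset.prod_nonneg fun i _ => (hpos₂ _).le) ?_
  calc ∑ x with φ x = y, ∏ i, W i (x i, y i) / Q i (y i)
      ≤ ∑ x : Fin n → A, ∏ i, W i (x i, y i) / Q i (y i) :=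
        Finset.sum_le_sum_of_subset_of_nonneg (Finset.filter_subset _ _) fun x _ _ =>
          Finset.prod_nonneg fun i _ => div_nonneg (hW0 _ _) (hQ0 _ _)
    _ = ∏ i, ∑ a, W i (a, y i) / Q i (y i) := by
        rw [Finset.prod_univ_sum, Fintype.piFinset_univ]
    _ ≤ 1 := by
        refine Finset.prod_le_one (fun i _ => Finset.sum_nonneg fun a _ =>
          div_nonneg (hW0 _ _) (hQ0 _ _)) fun i _ => ?_
        -- If `y` is outside the range of `φ`, `Q i (y i)` may be zero; the quotient is then 0 by
        -- convention, hence `≤ 1` rather than equality.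
        rw [← Finset.sum_div, hWQ]
        exact div_self_le_one _

/-- The sphere-covering bound, for the Hamming distortion. -/
lemma exp_mul_errorExponent_le [DecidableEq A] (hP₁ : P₁ ∈ stdSimplex ℝ A) (hpos₁ : ∀ a, 0 < P₁ a)
    (hpos₂ : ∀ a, 0 < P₂ a) (hn : 1 ≤ n) {C : Finset (Fin n → A)} (hC : C.Nonempty) :
    EReal.exp (-(((n : ℝ) : EReal) * errorExponent P₁ P₂ (errorOne P₁ C))) ≤
      ENNReal.ofReal (errorTwo P₂ C) := by
  obtain ⟨c, hc⟩ := hC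
  set φ : (Fin n → A) → Fin n → A := fun x => if x ∈ C then x else c with hφdef
  have hφ : ∀ x, φ x ∈ C := fun x => by
    simp only [hφdef]; split_ifs with h
    exacts [h, hc]
  set p : (Fin n → A) → ℝ := fun x => ∏ k, P₁ (x k) with hp
  have hps : p ∈ stdSimplex ℝ (Fin n → A) := prod_mem_stdSimplex hP₁
  set W : Fin n → A × A → ℝ := fun i => law p fun x => (x i, φ x i) with hW
  set Q : Fin n → A → ℝ := fun i => law p fun x => φ x i with hQ
  have hmem : ∀ i, W i ∈ couplings hamming P₁ (Q i) (errorOne P₁ C) := fun i => by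
    refine ⟨law_mem_stdSimplex hps _, fun a => ?_, fun b => sum_law_prod_right _ _ _ _, ?_⟩
    · rw [hW, sum_law_prod_left]
      have := sum_prod_mul_apply (n := n) hP₁.2 (fun b => if b = a then 1 else 0) i
      simpa [law, hp] using this
    · rw [hW, sum_law_mul p (fun x => (x i, φ x i)) fun z => hamming z.1 z.2, errorOne, prodMass,
        ← Finset.sum_subset (Finset.subset_univ Cᶜ)]
      · refine Finset.sum_le_sum fun x _ => mul_le_of_le_one_right (hps.1 x) ?_
        unfold hamming; split_ifs <;> norm_num
      · intro x _ hx
        have hx : x ∈ C := by simpa using hx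
        simp [hφdef, hx, hamming]
  set r : Fin n → ℝ := fun i => ∑ z, W i z * Real.log (W i z / (P₁ z.1 * Q i z.2)) +
      ∑ y, Q i y * Real.log (P₂ y) with hr
  have hle : ∀ i, rateR hamming P₁ P₂ (errorOne P₁ C) ≤ (r i : EReal) := fun i =>
    rateR_le hpos₁ (law_mem_stdSimplex hps _) (hmem i)
  have hmain : Real.exp (∑ i, r i) ≤ prodMass P₂ C :=
    exp_sum_le_prodMass hP₁ hpos₁ hpos₂ hφ hp hW hQ
  have hn0 : (0 : ℝ) < n := by exact_mod_cast hn
  have : NeZero n := ⟨by omega⟩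
  -- The cheapest coordinate bounds `R`, and `n` times its cost is at most the sum.
  obtain ⟨i, -, hi⟩ := Finset.exists_min_image univ r univ_nonempty
  have hsum : n * r i ≤ ∑ j, r j := by
    have := Finset.card_nsmul_le_sum univ r (r i) fun j hj => hi j hj
    simpa using this
  have : -(((n : ℝ) : EReal) * errorExponent P₁ P₂ (errorOne P₁ C)) ≤ ((∑ j, r j : ℝ) : EReal) := by
    rw [errorExponent, mul_neg, neg_neg]
    refine (mul_le_mul_of_nonneg_left (hle i) (by exact_mod_cast hn0.le)).trans ?_
    exact_mod_cast hsum
  refine (EReal.exp_monotone this).trans ?_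
  rw [EReal.exp_coe]
  exact ENNReal.ofReal_le_ofReal hmain

end Converse

/-! ### Stein's lemma -/

section Stein

variable {A : Type*} {P₁ P₂ : A → ℝ} {n : ℕ}

lemma prodMass_nonneg {P : A → ℝ} (hP : ∀ a, 0 ≤ P a) (C : Finset (Fin n → A)) :
    0 ≤ prodMass P C :=
  Finset.sum_nonneg fun _ _ => Finset.prod_nonneg fun _ _ => hP _

lemma prodMass_mono {P : A → ℝ} (hP : ∀ a, 0 ≤ P a) {C D : Finset (Fin n → A)} (h : C ⊆ D) :
    prodMass P C ≤ prodMass P D :=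
  Finset.sum_le_sum_of_subset_of_nonneg h fun _ _ _ => Finset.prod_nonneg fun _ _ => hP _

lemma prodMass_union_le [DecidableEq A] {P : A → ℝ} (hP : ∀ a, 0 ≤ P a) (C D : Finset (Fin n → A)) :
    prodMass P (C ∪ D) ≤ prodMass P C + prodMass P D := by
  have h := Finset.sum_union_inter (s₁ := C) (s₂ := D) (f := fun y => ∏ i, P (y i))
  have := prodMass_nonneg hP (C ∩ D)
  simp only [prodMass] at *
  linarith

lemma normLog_of_pos (n : ℕ) {b : ℝ} (hb : 0 < b) :
    normLog n b = ((1 / n * Real.log b : ℝ) : EReal) := by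
  rw [normLog, ENNReal.log_ofReal_of_pos hb, ← EReal.coe_mul]

/-- A vanishing tolerance, slow enough for Chebyshev's inequality. -/
noncomputable def tolerance (n : ℕ) : ℝ := (n : ℝ) ^ (-(1 / 4) : ℝ)

lemma tolerance_pos (hn : 1 ≤ n) : 0 < tolerance n :=
  Real.rpow_pos_of_pos (by exact_mod_cast hn) _

lemma tendsto_tolerance : Tendsto tolerance atTop (𝓝 0) :=
  (tendsto_rpow_neg_atTop (by norm_num)).comp tendsto_natCast_atTop_atTop

variable [Fintype A]

/-- The real number underlying the relative entropy `H(P₁‖P₂)`. -/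
noncomputable def divergence (P₁ P₂ : A → ℝ) : ℝ := ∑ a, P₁ a * Real.log (P₁ a / P₂ a)

lemma relEntropy_eq_divergence (hpos₂ : ∀ a, 0 < P₂ a) :
    relEntropy P₁ P₂ = (divergence P₁ P₂ : EReal) := by
  rw [relEntropy, if_pos fun a h => absurd h (hpos₂ a).ne', divergence]

/-- The sequences whose log-likelihood ratio is within `n ε` of its mean under `P₁`. -/
noncomputable def typicalSet (P₁ P₂ : A → ℝ) (n : ℕ) (ε : ℝ) : Finset (Fin n → A) :=
  {x | |∑ i, (Real.log (P₁ (x i) / P₂ (x i)) - divergence P₁ P₂)| ≤ n * ε}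

/-- The variance of the log-likelihood ratio under `P₁`. -/
noncomputable def llrVariance (P₁ P₂ : A → ℝ) : ℝ :=
  ∑ a, P₁ a * (Real.log (P₁ a / P₂ a) - divergence P₁ P₂) ^ 2

lemma prod_eq_exp_mul (hpos₁ : ∀ a, 0 < P₁ a) (hpos₂ : ∀ a, 0 < P₂ a) (x : Fin n → A) :
    ∏ i, P₂ (x i) = Real.exp (-(n * divergence P₁ P₂) -
      ∑ i, (Real.log (P₁ (x i) / P₂ (x i)) - divergence P₁ P₂)) * ∏ i, P₁ (x i) := by
  have : -(n * divergence P₁ P₂) - ∑ i, (Real.log (P₁ (x i) / P₂ (x i)) - divergence P₁ P₂)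
      = ∑ i, -Real.log (P₁ (x i) / P₂ (x i)) := by
    simp [Finset.sum_sub_distrib, Finset.sum_neg_distrib]
    ring
  rw [this, Real.exp_sum, ← Finset.prod_mul_distrib]
  refine Finset.prod_congr rfl fun i _ => ?_
  have h₁ := hpos₁ (x i)
  have h₂ := hpos₂ (x i)
  rw [Real.exp_neg, Real.exp_log (div_pos h₁ h₂)]
  field_simp

lemma prodMass_le_of_subset_typicalSet (hpos₁ : ∀ a, 0 < P₁ a)
    (hpos₂ : ∀ a, 0 < P₂ a) {ε : ℝ} {C : Finset (Fin n → A)} (hC : C ⊆ typicalSet P₁ P₂ n ε) :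
    prodMass P₂ C ≤ Real.exp (-(n * (divergence P₁ P₂ - ε))) * prodMass P₁ C := by
  rw [prodMass, prodMass, Finset.mul_sum]
  refine Finset.sum_le_sum fun x hx => ?_
  rw [prod_eq_exp_mul hpos₁ hpos₂]
  have := (abs_le.1 (Finset.mem_filter.1 (hC hx)).2).1
  refine mul_le_mul_of_nonneg_right (Real.exp_le_exp.2 ?_)
    (Finset.prod_nonneg fun _ _ => (hpos₁ _).le)
  linarith

lemma le_prodMass_of_subset_typicalSet (hpos₁ : ∀ a, 0 < P₁ a)
    (hpos₂ : ∀ a, 0 < P₂ a) {ε : ℝ} {C : Finset (Fin n → A)} (hC : C ⊆ typicalSet P₁ P₂ n ε) :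
    Real.exp (-(n * (divergence P₁ P₂ + ε))) * prodMass P₁ C ≤ prodMass P₂ C := by
  rw [prodMass, prodMass, Finset.mul_sum]
  refine Finset.sum_le_sum fun x hx => ?_
  rw [prod_eq_exp_mul hpos₁ hpos₂]
  have := (abs_le.1 (Finset.mem_filter.1 (hC hx)).2).2
  refine mul_le_mul_of_nonneg_right (Real.exp_le_exp.2 ?_)
    (Finset.prod_nonneg fun _ _ => (hpos₁ _).le)
  linarith

variable [DecidableEq A]

lemma prodMass_add_compl {P : A → ℝ} (hP : P ∈ stdSimplex ℝ A) (C : Finset (Fin n → A)) :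
    prodMass P C + prodMass P Cᶜ = 1 := by
  rw [prodMass, prodMass, Finset.sum_add_sum_compl]
  exact (prod_mem_stdSimplex hP).2

lemma prodMass_typicalSet_compl_le (hP₁ : P₁ ∈ stdSimplex ℝ A) {ε : ℝ} (hε : 0 < ε)
    (hn : 1 ≤ n) :
    prodMass P₁ (typicalSet P₁ P₂ n ε)ᶜ ≤ llrVariance P₁ P₂ / (n * ε ^ 2) := by
  have hn0 : (0 : ℝ) < n := by exact_mod_cast hn
  set g : A → ℝ := fun a => Real.log (P₁ a / P₂ a) - divergence P₁ P₂ with hg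
  have hg0 : ∑ a, P₁ a * g a = 0 := by
    simp [hg, mul_sub, ← Finset.sum_mul, hP₁.2, divergence]
  have hvar := sum_prod_mul_sq (n := n) hP₁.2 hg0
  have hp := (prod_mem_stdSimplex (n := n) hP₁).1
  have hcheb : prodMass P₁ (typicalSet P₁ P₂ n ε)ᶜ * (n * ε) ^ 2 ≤ n * llrVariance P₁ P₂ := by
    rw [llrVariance, ← hvar, prodMass, Finset.sum_mul]
    refine (Finset.sum_le_sum fun x hx => ?_).trans (Finset.sum_le_sum_of_subset_of_nonneg
      (Finset.subset_univ _) fun x _ _ => mul_nonneg (hp x) (sq_nonneg _))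
    refine mul_le_mul_of_nonneg_left ?_ (hp x)
    have hx : n * ε < |∑ i, g (x i)| := by
      simpa only [typicalSet, Finset.mem_compl, Finset.mem_filter, mem_univ, true_and, not_le]
        using hx
    rw [← sq_abs (∑ i, g (x i))]
    exact pow_le_pow_left₀ (by positivity) hx.le 2
  rw [le_div_iff₀ (by positivity)]
  refine le_of_mul_le_mul_left ?_ hn0
  linarith

lemma tendsto_prodMass_typicalSet_compl (hP₁ : P₁ ∈ stdSimplex ℝ A) :
    Tendsto (fun n => prodMass P₁ (typicalSet P₁ P₂ n (tolerance n))ᶜ) atTop (𝓝 0) := by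
  have hlim : Tendsto (fun n : ℕ => llrVariance P₁ P₂ * (n : ℝ) ^ (-(1 / 2) : ℝ)) atTop (𝓝 0) := by
    simpa using ((tendsto_rpow_neg_atTop (y := 1 / 2) (by norm_num)).comp
      tendsto_natCast_atTop_atTop).const_mul (llrVariance P₁ P₂)
  refine squeeze_zero' (Eventually.of_forall fun n => prodMass_nonneg hP₁.1 _) ?_ hlim
  filter_upwards [eventually_ge_atTop 1] with n hn
  refine (prodMass_typicalSet_compl_le hP₁ (tolerance_pos hn) hn).trans_eq ?_
  have hn0 : (0 : ℝ) < n := by exact_mod_cast hn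
  -- The exponent `1/4` turns the Chebyshev bound into variance over `√n`.
  have : (n : ℝ) * tolerance n ^ 2 = (n : ℝ) ^ (1 / 2 : ℝ) := by
    rw [tolerance, ← Real.rpow_natCast, ← Real.rpow_mul hn0.le]
    nth_rewrite 1 [← Real.rpow_one (n : ℝ)]
    rw [← Real.rpow_add hn0]
    norm_num
  rw [this, Real.rpow_neg hn0.le, div_eq_mul_inv]

/-- Converse part of Stein's lemma. -/
lemma neg_relEntropy_le_liminf (hP₁ : P₁ ∈ stdSimplex ℝ A)
    (hpos₁ : ∀ a, 0 < P₁ a) (hpos₂ : ∀ a, 0 < P₂ a) {C : ∀ n : ℕ, Finset (Fin n → A)}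
    (hC : Tendsto (fun n => errorOne P₁ (C n)) atTop (𝓝 0)) :
    -relEntropy P₁ P₂ ≤ liminf (fun n => normLog n (errorTwo P₂ (C n))) atTop := by
  rw [relEntropy_eq_divergence hpos₂, ← EReal.coe_neg]
  have hlim : Tendsto (fun n : ℕ => -(divergence P₁ P₂ + tolerance n) - Real.log 2 * (n : ℝ)⁻¹)
      atTop (𝓝 (-divergence P₁ P₂)) := by
    simpa using ((tendsto_tolerance.const_add (divergence P₁ P₂)).neg.sub
      (tendsto_inv_atTop_nhds_zero_nat (𝕜 := ℝ) |>.const_mul (Real.log 2)))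
  have hlim' := (continuous_coe_real_ereal.tendsto _).comp hlim
  rw [← hlim'.liminf_eq]
  refine liminf_le_liminf ?_
  have hsum := hC.add (tendsto_prodMass_typicalSet_compl (P₂ := P₂) hP₁)
  rw [add_zero] at hsum
  filter_upwards [eventually_ge_atTop 1, hsum.eventually_le_const (u := 1 / 2) (by norm_num)]
    with n hn hhalf
  have hn0 : (0 : ℝ) < n := by exact_mod_cast hn
  set T := typicalSet P₁ P₂ n (tolerance n)
  have hmass : 1 / 2 ≤ prodMass P₁ (C n ∩ T) := by
    have h₁ := prodMass_add_compl hP₁ (C n ∩ T)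
    have h₂ := prodMass_union_le hP₁.1 (C n)ᶜ Tᶜ
    rw [Finset.compl_inter] at h₁
    rw [errorOne] at hhalf
    linarith
  -- The factor `1/2` costs only `log 2 / n` in the exponent.
  have hbound : Real.exp (-(n * (divergence P₁ P₂ + tolerance n))) * (1 / 2)
      ≤ errorTwo P₂ (C n) :=
    (mul_le_mul_of_nonneg_left hmass (Real.exp_pos _).le).trans
      ((le_prodMass_of_subset_typicalSet hpos₁ hpos₂ Finset.inter_subset_right).trans
        (prodMass_mono (fun a => (hpos₂ a).le) Finset.inter_subset_left))
  have hpos : 0 < Real.exp (-(n * (divergence P₁ P₂ + tolerance n))) * (1 / 2) := by positivity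
  rw [normLog_of_pos n (hpos.trans_le hbound)]
  refine EReal.coe_le_coe_iff.2 ?_
  have hlog := Real.log_le_log hpos hbound
  rw [Real.log_mul (Real.exp_pos _).ne' (by norm_num), Real.log_exp, one_div, Real.log_inv] at hlog
  calc -(divergence P₁ P₂ + tolerance n) - Real.log 2 * (n : ℝ)⁻¹
      = 1 / n * (-(n * (divergence P₁ P₂ + tolerance n)) + -Real.log 2) := by
        field_simp
        ring
    _ ≤ _ := mul_le_mul_of_nonneg_left hlog (by positivity)

/-- Achievability part of Stein's lemma. -/
lemma tendsto_normLog_errorTwo_typicalSet (hP₁ : P₁ ∈ stdSimplex ℝ A)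
    (hpos₁ : ∀ a, 0 < P₁ a) (hpos₂ : ∀ a, 0 < P₂ a) :
    Tendsto (fun n => normLog n (errorTwo P₂ (typicalSet P₁ P₂ n (tolerance n)))) atTop
      (𝓝 (-relEntropy P₁ P₂)) := by
  refine tendsto_of_le_liminf_of_limsup_le
    (neg_relEntropy_le_liminf hP₁ hpos₁ hpos₂ (tendsto_prodMass_typicalSet_compl hP₁)) ?_
  rw [relEntropy_eq_divergence hpos₂, ← EReal.coe_neg]
  have hlim : Tendsto (fun n : ℕ => -(divergence P₁ P₂ - tolerance n))
      atTop (𝓝 (-divergence P₁ P₂)) := by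
    simpa using (tendsto_tolerance.const_sub (divergence P₁ P₂)).neg
  have hlim' := (continuous_coe_real_ereal.tendsto _).comp hlim
  rw [← hlim'.limsup_eq]
  refine limsup_le_limsup ?_
  filter_upwards [eventually_ge_atTop 1] with n hn
  have hn0 : (0 : ℝ) < n := by exact_mod_cast hn
  set T := typicalSet P₁ P₂ n (tolerance n)
  have hT1 : prodMass P₁ T ≤ 1 := by
    have h₁ := prodMass_add_compl hP₁ T
    have h₂ := prodMass_nonneg hP₁.1 Tᶜ
    linarith
  have hbound : errorTwo P₂ T ≤ Real.exp (-(n * (divergence P₁ P₂ - tolerance n))) :=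
    (prodMass_le_of_subset_typicalSet hpos₁ hpos₂ subset_rfl).trans
      (mul_le_of_le_one_right (Real.exp_pos _).le hT1)
  -- The comparison is made in `EReal` because `T` is not known to be nonempty, so the logarithm may
  -- be `-∞`.
  have hmono : normLog n (errorTwo P₂ T)
      ≤ normLog n (Real.exp (-(n * (divergence P₁ P₂ - tolerance n)))) := by
    refine mul_le_mul_of_nonneg_left ?_ (by exact_mod_cast (by positivity : 0 ≤ 1 / (n : ℝ)))
    exact ENNReal.log_monotone (ENNReal.ofReal_le_ofReal hbound)
  refine hmono.trans_eq ?_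
  rw [normLog_of_pos n (Real.exp_pos _), Real.log_exp]
  simp only [Function.comp]
  congr 1
  field_simp

end Stein

end SphereCovering

theorem corollary1 {A : Type*} [Fintype A] [DecidableEq A] (P₁ P₂ : A → ℝ)
    (hP₁ : P₁ ∈ stdSimplex ℝ A) (hP₂ : P₂ ∈ stdSimplex ℝ A)
    (hpos₁ : ∀ a, 0 < P₁ a) (hpos₂ : ∀ a, 0 < P₂ a) :
    (∀ C : ∀ n : ℕ, Finset (Fin n → A),
      (∀ n : ℕ, 1 ≤ n → (C n).Nonempty →
        EReal.exp (-(((n : ℝ) : EReal) *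
            SphereCovering.errorExponent P₁ P₂ (SphereCovering.errorOne P₁ (C n)))) ≤
          ENNReal.ofReal (SphereCovering.errorTwo P₂ (C n))) ∧
      (Tendsto (fun n => SphereCovering.errorOne P₁ (C n)) atTop (𝓝 0) →
        -SphereCovering.relEntropy P₁ P₂ ≤
          liminf (fun n => SphereCovering.normLog n (SphereCovering.errorTwo P₂ (C n))) atTop)) ∧
    (∃ C : ∀ n : ℕ, Finset (Fin n → A),
      Tendsto (fun n => SphereCovering.errorOne P₁ (C n)) atTop (𝓝 0) ∧
      Tendsto (fun n => SphereCovering.normLog n (SphereCovering.errorTwo P₂ (C n))) atTop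
        (𝓝 (-SphereCovering.relEntropy P₁ P₂))) := by

  refine ⟨fun C => ⟨fun n hn hC =>
    SphereCovering.exp_mul_errorExponent_le hP₁ hpos₁ hpos₂ hn hC, fun hC =>
    SphereCovering.neg_relEntropy_le_liminf hP₁ hpos₁ hpos₂ hC⟩,
    fun n => SphereCovering.typicalSet P₁ P₂ n (SphereCovering.tolerance n),
    SphereCovering.tendsto_prodMass_typicalSet_compl hP₁,
    SphereCovering.tendsto_normLog_errorTwo_typicalSet hP₁ hpos₁ hpos₂⟩
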